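/- Let $K\le M$ be natural numbers (users, antennas) and let $(h_n^{km})$, $n=1,2,\dots$, $1\le k\le K$, $1\le m\le M$, be mutually independent complex random variables on a probability space with $\mathbb E[h_n^{km}]=0$, $\mathbb E[|h_n^{km}|^2]=1$, $\mathbb E[(h_n^{km})^2]=0$ (as holds for circularly symmetric coefficients), which for each $k,m$ satisfy Lindeberg's condition: for every $\varepsilon>0$, $$\frac1N\sum_{n=1}^N\mathbb E\big[|h_n^{km}|^2\,\mathbf 1\{|h_n^{km}|>\varepsilon\sqrt N\}\big]\to0\quad(N\to\infty)$$ (automatic when the $h_n^{km}$ are identically distributed in $n$). Let $\Gamma\in(0,1]$, and for each $N$ let deterministic phase shifts $\theta_{1},\dots,\theta_{N}\in\mathbb R$ be given (they may depend on $N$), with reflection factors $\Gamma_{n}=\Gamma e^{-j\theta_{n}}$. Write $\mathcal{CN}(0,1)$ for the law of $x+jy$ with $x,y$ independent real centred Gaussians of variance $1/2$. (i) For all $k,m$, as $N\to\infty$, $$\frac{\sum_{n=1}^N h_n^{km}\Gamma_{n}}{\Gamma\sqrt N}\;\longrightarrow\;\mathcal{CN}(0,1)\quad\text{in distribution.}$$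 (ii) Consequently the phase shifts do not affect the asymptotic distribution of the signal-to-noise ratio (SNR) under zero-forcing. Precisely, let $P>0$, $\sigma>0$, let $\Lambda\in\mathbb C^{K\times K}$ satisfy $\mathrm{Tr}\{\Lambda\Lambda^H\}=1$, and for each $N$ let $\bar\beta^1_N,\dots,\bar\beta^K_N>0$ be deterministic path losses. For a $K\times M$ complex matrix $G$ put $V=G^H(GG^H)^{-1}$ and $$\gamma_k(G)=\frac{P[\Lambda\Lambda^H]_{kk}}{K\sigma^2}\,|g_kw_k|^2,$$ where $g_k$ is the $k$-th row of $G$, $w_k=v_k/\|v_k\|$, and $v_k$ is the $k$-th column of $V$ (with the convention $\gamma_k(G)=0$ if $GG^H$ is singular). Let $G_N$ be the $K\times M$ channel matrix with entries $(\bar\beta^k_N)^{-1/2}\sum_{n=1}^N h_n^{km}\Gamma_{n}$. Then for every $k$, as $N\to\infty$, $$\frac{\bar\beta^k_N}{\Gamma^2N}\,\gamma_k(G_N)\;\longrightarrow\;\gamma_k(Z)\quad\text{in distribution,}$$ where $Z$ is a $K\times M$ matrix with independent $\mathcal{CN}(0,1)$ entries. In particular, the limit law is the same for every choice of the phase shifts.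 -/

import Mathlib

open MeasureTheory ProbabilityTheory Filter Topology
open scoped NNReal ENNReal Matrix

noncomputable section

/-- The circularly symmetric complex Gaussian law `CN(0, v)`: the law of `x + i y` with `x`, `y`
independent real centred Gaussians of variance `v / 2` each. -/
def complexGaussian (v : ℝ≥0) : Measure ℂ :=
  ((gaussianReal 0 (v / 2)).prod (gaussianReal 0 (v / 2))).map
    (fun p : ℝ × ℝ => (p.1 : ℂ) + (p.2 : ℂ) * Complex.I)

instance isProbabilityMeasure_complexGaussian (v : ℝ≥0) :
    IsProbabilityMeasure (complexGaussian v) :=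
  Measure.isProbabilityMeasure_map (by fun_prop)

/-- The law of a `K × M` array with independent `CN(0, 1)` entries. -/
def complexGaussianArray (K M : ℕ) : Measure (Fin K → Fin M → ℂ) :=
  Measure.pi fun _ => Measure.pi fun _ => complexGaussian 1

instance isProbabilityMeasure_complexGaussianArray (K M : ℕ) :
    IsProbabilityMeasure (complexGaussianArray K M) :=
  inferInstanceAs (IsProbabilityMeasure
    (Measure.pi fun _ : Fin K => Measure.pi fun _ : Fin M => complexGaussian 1))

/-- Lindeberg's condition for a sequence of centred complex random variables of unit variance. -/
def LindebergCondition {Ω : Type*} [MeasurableSpace Ω] (μ : Measure Ω) (X : ℕ → Ω → ℂ) : Prop :=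
  ∀ ε : ℝ, 0 < ε →
    Tendsto (fun N : ℕ => (N : ℝ)⁻¹ * ∑ n ∈ Finset.range N,
      ∫ ω in {ω | ε * √(N : ℝ) < ‖X n ω‖}, ‖X n ω‖ ^ 2 ∂μ) atTop (𝓝 0)

/-- A fading model: independent, centred, unit-variance complex coefficients `h n k m` (element
`n`, user `k`, antenna `m`) that are proper (vanishing pseudo-variance, the second-order form of
circular symmetry) and, for each `k`, `m`, satisfy Lindeberg's condition in `n`. -/
structure IsFading {Ω : Type*} [MeasurableSpace Ω] (μ : Measure Ω) {K M : ℕ}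
    (h : ℕ → Fin K → Fin M → Ω → ℂ) : Prop where
  memLp : ∀ n k m, MemLp (h n k m) 2 μ
  indep : iIndepFun (fun i : ℕ × Fin K × Fin M => h i.1 i.2.1 i.2.2) μ
  mean : ∀ n k m, ∫ ω, h n k m ω ∂μ = 0
  variance : ∀ n k m, ∫ ω, ‖h n k m ω‖ ^ 2 ∂μ = 1
  pseudoVariance : ∀ n k m, ∫ ω, h n k m ω ^ 2 ∂μ = 0
  lindeberg : ∀ k m, LindebergCondition μ (fun n => h n k m)

/-- The reflection factor `Γ e^{-jθ}` of an element with amplitude `Γ` and phase shift `θ`. -/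
def reflectionFactor (Γ θ : ℝ) : ℂ := (Γ : ℂ) * Complex.exp (-((θ : ℂ) * Complex.I))

/-- The matrix `H` of a surface with `N` elements (numbered `0, …, N - 1`) and phase shifts
`θ 0, …, θ (N - 1)`; its entry for user `k` and antenna `m` is the sum of the `h n k m` weighted
by the reflection factors. `x n k m` are the values of the fading coefficients. -/
def reflectedMatrix {K M : ℕ} (Γ : ℝ) (N : ℕ) (θ : ℕ → ℝ) (x : ℕ → Fin K → Fin M → ℂ) :
    Matrix (Fin K) (Fin M) ℂ :=
  Matrix.of fun k m => ∑ n ∈ Finset.range N, x n k m * reflectionFactor Γ (θ n)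

/-- The channel matrix `G = B^{-1/2} H`, with `B` the diagonal matrix of the path losses `β k`. -/
def channelMatrix {K M : ℕ} (β : Fin K → ℝ) (H : Matrix (Fin K) (Fin M) ℂ) :
    Matrix (Fin K) (Fin M) ℂ :=
  Matrix.diagonal (fun k => (((√(β k))⁻¹ : ℝ) : ℂ)) * H

/-- The unnormalized zero-forcing matrix `V = Gᴴ (G Gᴴ)⁻¹`. -/
def zfMatrix {K M : ℕ} (G : Matrix (Fin K) (Fin M) ℂ) : Matrix (Fin M) (Fin K) ℂ :=
  Gᴴ * (G * Gᴴ)⁻¹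

/-- The zero-forcing precoder `W`: the columns of `V` divided by their Euclidean norms. -/
def zfPrecoder {K M : ℕ} (G : Matrix (Fin K) (Fin M) ℂ) : Matrix (Fin M) (Fin K) ℂ :=
  Matrix.of fun m k => zfMatrix G m k / ((√(∑ i, ‖zfMatrix G i k‖ ^ 2) : ℝ) : ℂ)

/-- The signal-to-noise ratio `P Λ_k / (K σ²) · (g_k w_k) (g_k w_k)ᴴ` of user `k` under
zero-forcing, where `Λ_k = [Λ Λᴴ]_{kk}`, `g_k` is row `k` of `G` and `w_k` column `k` of `W`. -/
def snr {K M : ℕ} (P σ : ℝ) (Λ : Matrix (Fin K) (Fin K) ℂ) (G : Matrix (Fin K) (Fin M) ℂ)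
    (k : Fin K) : ℝ :=
  P * ((Λ * Λᴴ) k k).re / (K * σ ^ 2) * ‖(G * zfPrecoder G) k k‖ ^ 2

end

/-! The phases disappear because a proper variable `X` has isotropic second moments: `E⟪X, t⟫² =
‖t‖²/2` in every direction `t`, and multiplying `X` by a unimodular number only rotates `t`. Each
normalized summand thus has characteristic function `1 - ‖t‖²/(4N)` up to an error whose sum over
`n` vanishes by Lindeberg's condition, so the product tends to `exp(-‖t‖²/4)`
(`tendstoInDistribution_sum_rotated`).

For the SNR, distinct entries of the normalized matrix are independent for each `N`, so entrywise
convergence is joint (`IsFading.tendstoInDistribution_array`). Zero-forcing is equivariant under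
positive row scalings, hence the normalized SNR is exactly the SNR of the normalized matrix
(`snr_channelMatrix_div`). That function is continuous wherever the Gram determinant is nonzero,
which holds almost surely at the Gaussian limit because `K ≤ M`; the continuous mapping theorem
concludes. -/

/-! ### Weak convergence, independence and product measures -/

/-- **Continuous mapping theorem** for a map that is almost surely continuous at the limit. -/
theorem MeasureTheory.TendstoInDistribution.comp_of_ae_continuousAt {ι Ω' E F : Type*}
    {Ω : ι → Type*} {m : ∀ i, MeasurableSpace (Ω i)} {μ : ∀ i, Measure (Ω i)}
    [∀ i, IsProbabilityMeasure (μ i)] [MeasurableSpace Ω'] {μ' : Measure Ω'}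
    [IsProbabilityMeasure μ'] [TopologicalSpace E] [MeasurableSpace E] [OpensMeasurableSpace E]
    [HasOuterApproxClosed E] [TopologicalSpace F] [MeasurableSpace F] [OpensMeasurableSpace F]
    {X : ∀ i, Ω i → E} {Z : Ω' → E} {l : Filter ι} [l.IsCountablyGenerated] {g : E → F}
    (h : TendstoInDistribution X l Z μ μ') (hg : Measurable g)
    (hc : ∀ᵐ ω ∂μ', ContinuousAt g (Z ω)) :
    TendstoInDistribution (fun i => g ∘ X i) l (g ∘ Z) μ μ' where
  forall_aemeasurable i := hg.comp_aemeasurable (h.forall_aemeasurable i)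
  aemeasurable_limit := hg.comp_aemeasurable h.aemeasurable_limit
  tendsto := by
    refine tendsto_of_forall_isClosed_limsup_le' fun S hS => ?_
    have key := ProbabilityMeasure.limsup_measure_closed_le_of_tendsto h.tendsto
      (isClosed_closure (s := g ⁻¹' S))
    simp only [ProbabilityMeasure.coe_mk] at key ⊢
    refine (limsup_le_limsup (Eventually.of_forall fun i => ?_)).trans (key.trans ?_)
    · rw [← AEMeasurable.map_map_of_aemeasurable hg.aemeasurable (h.forall_aemeasurable i),
        Measure.map_apply hg hS.measurableSet]
      exact measure_mono subset_closure
    · rw [Measure.map_apply_of_aemeasurable h.aemeasurable_limit isClosed_closure.measurableSet,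
        Measure.map_apply_of_aemeasurable (hg.comp_aemeasurable h.aemeasurable_limit)
          hS.measurableSet]
      -- A continuity point of `g` in the closure of `g ⁻¹' S` is mapped into the closed set `S`, so
      -- passing to the closure costs nothing under the limit law.
      refine measure_mono_ae ?_
      filter_upwards [hc] with ω hω hmem
      exact hS.closure_subset (hω.continuousWithinAt.mem_closure hmem (fun _ hx => hx))

/-- If a finite or countable array of random variables is independent, then so are its rows. -/
theorem ProbabilityTheory.iIndepFun.curry {Ω ι κ E : Type*} [MeasurableSpace Ω] {P : Measure Ω}
    [MeasurableSpace E] [Countable ι] [Countable κ] {X : ι → κ → Ω → E}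
    (hX : ∀ i j, AEMeasurable (X i j) P) (h : iIndepFun (fun p : ι × κ => X p.1 p.2) P) :
    iIndepFun (fun i ω j => X i j ω) P := by
  have := h.isProbabilityMeasure
  have (i : ι) (j : κ) : IsProbabilityMeasure (P.map (X i j)) :=
    Measure.isProbabilityMeasure_map (hX i j)
  have hm : AEMeasurable (fun ω (p : ι × κ) => X p.1 p.2 ω) P :=
    aemeasurable_pi_iff.2 fun p => hX p.1 p.2
  have hrow (i : ι) : P.map (fun ω j => X i j ω) = Measure.infinitePi fun j => P.map (X i j) :=
    iIndepFun.map_fun_eq_infinitePi_map₀' (hX i)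
      (h.precomp (g := fun j => (i, j)) fun a b hab => (Prod.ext_iff.1 hab).2)
  rw [iIndepFun_iff_map_fun_eq_infinitePi_map₀' fun i => aemeasurable_pi_iff.2 (hX i)]
  simp_rw [hrow]
  rw [← Measure.infinitePi_map_curry, ← h.map_fun_eq_infinitePi_map₀ hm,
    AEMeasurable.map_map_of_aemeasurable (by fun_prop) hm]
  rfl

/-- A finite product of absolutely continuous measures is absolutely continuous. -/
theorem MeasureTheory.Measure.AbsolutelyContinuous.pi_fin {n : ℕ} {E : Type*} [MeasurableSpace E]
    {μ ν : Fin n → Measure E} [∀ i, SigmaFinite (μ i)] [∀ i, SigmaFinite (ν i)]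
    (h : ∀ i, μ i ≪ ν i) : Measure.pi μ ≪ Measure.pi ν := by
  induction n with
  | zero =>
    rw [Measure.pi_of_empty, Measure.pi_of_empty]
  | succ n ih =>
    have h1 := (measurePreserving_piFinSuccAbove μ 0).symm
    have h2 := (measurePreserving_piFinSuccAbove ν 0).symm
    rw [← h1.map_eq, ← h2.map_eq]
    exact ((h 0).prod (ih fun i => h _)).map h1.measurable

/-! ### Elementary complex estimates -/

/-- Products of complex numbers in the unit disc differ by at most the sum of the differences. -/
theorem norm_prod_sub_prod_le_sum {ι : Type*} (s : Finset ι) (a b : ι → ℂ)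
    (ha : ∀ i ∈ s, ‖a i‖ ≤ 1) (hb : ∀ i ∈ s, ‖b i‖ ≤ 1) :
    ‖∏ i ∈ s, a i - ∏ i ∈ s, b i‖ ≤ ∑ i ∈ s, ‖a i - b i‖ := by
  classical
  induction s using Finset.induction_on with
  | empty => simp
  | insert i s hi ih =>
    simp only [Finset.mem_insert, forall_eq_or_imp] at ha hb
    rw [Finset.prod_insert hi, Finset.prod_insert hi, Finset.sum_insert hi]
    have hp : ‖∏ i ∈ s, a i‖ ≤ 1 := by
      rw [norm_prod]
      exact Finset.prod_le_one (fun _ _ => norm_nonneg _) ha.2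
    calc ‖a i * ∏ i ∈ s, a i - b i * ∏ i ∈ s, b i‖
        = ‖(a i - b i) * ∏ i ∈ s, a i + b i * (∏ i ∈ s, a i - ∏ i ∈ s, b i)‖ := by ring_nf
      _ ≤ ‖a i - b i‖ * ‖∏ i ∈ s, a i‖ + ‖b i‖ * ‖∏ i ∈ s, a i - ∏ i ∈ s, b i‖ := by
        rw [← norm_mul, ← norm_mul]
        exact norm_add_le _ _
      _ ≤ ‖a i - b i‖ * 1 + 1 * ∑ i ∈ s, ‖a i - b i‖ := by
        gcongr
        exacts [hb.1, ih ha.2 hb.2]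
      _ = _ := by ring

/-- Second-order Taylor expansion of `exp (i x)`, with quadratic and cubic remainder bounds. -/
theorem norm_exp_mul_I_sub_taylor_le (x : ℝ) :
    ‖Complex.exp (x * Complex.I) - (1 + x * Complex.I - x ^ 2 / 2)‖ ≤ 4 * x ^ 2 ∧
      ‖Complex.exp (x * Complex.I) - (1 + x * Complex.I - x ^ 2 / 2)‖ ≤ 4 * |x| ^ 3 := by
  rcases le_total |x| 1 with hx | hx
  · have h : ‖Complex.exp (x * Complex.I) - (1 + x * Complex.I - x ^ 2 / 2)‖ ≤ |x| ^ 3 := by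
      have := Complex.exp_bound (x := x * Complex.I) (by simpa using hx) (n := 3) (by norm_num)
      simp only [Finset.sum_range_succ, Finset.range_zero, Finset.sum_empty, norm_mul,
        Complex.norm_I, Complex.norm_real, Real.norm_eq_abs, mul_pow, Complex.I_sq] at this
      norm_num [Nat.factorial] at this
      calc _ = _ := by congr 1; ring
        _ ≤ _ := this
        _ ≤ _ := by nlinarith [pow_nonneg (abs_nonneg x) 3]
    have h3 : |x| ^ 3 ≤ x ^ 2 := by
      rw [← sq_abs x]
      exact pow_le_pow_of_le_one (abs_nonneg x) hx (by norm_num)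
    constructor <;> nlinarith [pow_nonneg (abs_nonneg x) 3]
  -- For `|x| ≥ 1` the triangle inequality already suffices: `2 + |x| + x²/2 ≤ 4x² ≤ 4|x|³`.
  · have h : ‖Complex.exp (x * Complex.I) - (1 + x * Complex.I - x ^ 2 / 2)‖ ≤
        1 + (1 + |x| + |x| ^ 2 / 2) := by
      refine (norm_sub_le _ _).trans (add_le_add (Complex.norm_exp_ofReal_mul_I x).le ?_)
      refine (norm_sub_le _ _).trans (add_le_add ((norm_add_le _ _).trans_eq ?_) (le_of_eq ?_))
      · simp
      · simp
    rw [← sq_abs x]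
    constructor <;> nlinarith [mul_nonneg (sub_nonneg.2 hx) (sq_nonneg |x|)]

/-! ### Lindeberg's theorem through characteristic functions -/

section CentralLimit

open scoped RealInnerProductSpace ComplexConjugate

theorem charFun_complexGaussian (t : ℂ) :
    charFun (complexGaussian 1) t = Complex.exp (-(‖t‖ ^ 2 / 4 : ℝ)) := by
  have hexp (p : ℝ × ℝ) :
      Complex.exp (⟪(p.1 : ℂ) + (p.2 : ℂ) * Complex.I, t⟫ * Complex.I) =
        Complex.exp (t.re * p.1 * Complex.I) * Complex.exp (t.im * p.2 * Complex.I) := by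
    rw [← Complex.exp_add, Complex.inner]
    congr 1
    simp
    ring
  rw [charFun_apply, complexGaussian,
    integral_map (by fun_prop) (Continuous.aestronglyMeasurable (by fun_prop))]
  simp_rw [hexp]
  rw [integral_prod_mul (fun x : ℝ => Complex.exp (t.re * x * Complex.I))
    (fun x : ℝ => Complex.exp (t.im * x * Complex.I)), ← charFun_apply_real, ← charFun_apply_real,
    charFun_gaussianReal, charFun_gaussianReal, ← Complex.exp_add, Complex.sq_norm,
    Complex.normSq_apply]
  congr 1
  push_cast
  ring

section SecondMoments

variable {Ω : Type*} [MeasurableSpace Ω] {μ : Measure Ω} {Y : Ω → ℂ}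

/-- In the expansion `⟪Y, t⟫² = ‖t‖²‖Y‖²/2 + Re(t̄²Y²)/2` only the last term sees the direction of
`t`, and the vanishing pseudo-variance kills its mean. -/
theorem integral_inner_sq_of_proper (hY : MemLp Y 2 μ) (hv : ∫ ω, ‖Y ω‖ ^ 2 ∂μ = 1)
    (hp : ∫ ω, Y ω ^ 2 ∂μ = 0) (t : ℂ) : ∫ ω, ⟪Y ω, t⟫ ^ 2 ∂μ = ‖t‖ ^ 2 / 2 := by
  have hsq : Integrable (fun ω => Y ω ^ 2) μ := by
    refine (hY.integrable_norm_pow (by norm_num)).mono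
      (hY.aestronglyMeasurable.pow 2) (Eventually.of_forall fun ω => by simp)
  have hre (ω : Ω) : ⟪Y ω, t⟫ ^ 2 =
      ‖t‖ ^ 2 / 2 * ‖Y ω‖ ^ 2 + 2⁻¹ * (conj t ^ 2 * Y ω ^ 2).re := by
    rw [Complex.inner, Complex.sq_norm, Complex.sq_norm, Complex.normSq_apply, Complex.normSq_apply]
    simp [pow_two]
    ring
  have hint : ∫ ω, (conj t ^ 2 * Y ω ^ 2).re ∂μ = 0 := by
    refine (integral_re (𝕜 := ℂ) (hsq.const_mul (conj t ^ 2))).trans ?_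
    rw [integral_const_mul, hp]
    simp
  have hire : Integrable (fun ω => (conj t ^ 2 * Y ω ^ 2).re) μ := (hsq.const_mul _).re
  simp_rw [hre]
  rw [integral_add ((hY.integrable_norm_pow (by norm_num)).const_mul _)
    (hire.const_mul _), integral_const_mul, integral_const_mul, hint, hv]
  ring

/-- Truncated second-order expansion of the characteristic function of a proper complex random
variable of unit variance. -/
theorem norm_charFun_map_sub_le [IsProbabilityMeasure μ] (hY : MemLp Y 2 μ) (hm : ∫ ω, Y ω ∂μ = 0)
    (hv : ∫ ω, ‖Y ω‖ ^ 2 ∂μ = 1) (hp : ∫ ω, Y ω ^ 2 ∂μ = 0) (t : ℂ) {δ : ℝ} (hδ : 0 ≤ δ) :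
    ‖charFun (μ.map Y) t - ((1 - ‖t‖ ^ 2 / 4 : ℝ) : ℂ)‖ ≤
      4 * ‖t‖ ^ 3 * δ + 4 * ‖t‖ ^ 2 * ∫ ω in {ω | δ < ‖Y ω‖}, ‖Y ω‖ ^ 2 ∂μ := by
  have hYm := hY.aestronglyMeasurable
  have hs : NullMeasurableSet {ω | δ < ‖Y ω‖} μ :=
    nullMeasurableSet_lt aemeasurable_const hYm.norm.aemeasurable
  have hi1 : Integrable (fun ω => ⟪Y ω, t⟫) μ := (hY.integrable (by norm_num)).inner_const t
  have hn2 : Integrable (fun ω => ‖Y ω‖ ^ 2) μ := hY.integrable_norm_pow (by norm_num)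
  have hi2 : Integrable (fun ω => ⟪Y ω, t⟫ ^ 2) μ := by
    refine (hn2.mul_const (‖t‖ ^ 2)).mono (hi1.aestronglyMeasurable.pow 2)
      (Eventually.of_forall fun ω => ?_)
    rw [norm_pow, ← mul_pow, norm_pow, norm_mul, norm_norm, norm_norm]
    exact pow_le_pow_left₀ (norm_nonneg _) (norm_inner_le_norm (𝕜 := ℝ) _ _) 2
  have hi3 : Integrable (fun ω => Complex.exp (⟪Y ω, t⟫ * Complex.I)) μ := by
    refine Integrable.of_bound (Continuous.comp_aestronglyMeasurable (g := fun x : ℝ =>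
      Complex.exp (x * Complex.I)) (by fun_prop) hi1.aestronglyMeasurable) 1
      (Eventually.of_forall fun ω => (Complex.norm_exp_ofReal_mul_I _).le)
  have hmean : ∫ ω, ⟪Y ω, t⟫ ∂μ = 0 := by
    have := integral_inner (𝕜 := ℝ) (hY.integrable (by norm_num)) t
    simp_rw [real_inner_comm t] at this ⊢
    rw [this, hm, inner_zero_right]
  have hlin : Integrable (fun ω => (1 : ℂ) + ⟪Y ω, t⟫ * Complex.I - (⟪Y ω, t⟫ : ℂ) ^ 2 / 2) μ := by
    refine ((integrable_const 1).add (hi1.ofReal.mul_const _)).sub (Integrable.div_const ?_ _)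
    exact_mod_cast hi2.ofReal
  have hval : ∫ ω, ((1 : ℂ) + ⟪Y ω, t⟫ * Complex.I - (⟪Y ω, t⟫ : ℂ) ^ 2 / 2) ∂μ =
      ((1 - ‖t‖ ^ 2 / 4 : ℝ) : ℂ) := by
    have h2 : Integrable (fun ω => (⟪Y ω, t⟫ : ℂ) ^ 2 / 2) μ := by
      refine Integrable.div_const ?_ _
      exact_mod_cast hi2.ofReal
    have h3 : ∫ ω, (⟪Y ω, t⟫ : ℂ) ^ 2 ∂μ = ((‖t‖ ^ 2 / 2 : ℝ) : ℂ) := by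
      rw [← integral_inner_sq_of_proper hY hv hp t, ← integral_complex_ofReal]
      simp
    have h4 : ∫ ω, (⟪Y ω, t⟫ : ℂ) * Complex.I ∂μ = 0 := by
      rw [integral_mul_const, integral_complex_ofReal, hmean]
      simp
    have h5 : Integrable (fun ω => (⟪Y ω, t⟫ : ℂ) * Complex.I) μ := hi1.ofReal.mul_const _
    have h6 : Integrable (fun ω => (1 : ℂ) + (⟪Y ω, t⟫ : ℂ) * Complex.I) μ :=
      (integrable_const 1).add h5
    rw [integral_sub h6 h2, integral_add (integrable_const 1) h5, h4, integral_div, h3]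
    simp
    ring
  have hnn : 0 ≤ ∫ ω in {ω | δ < ‖Y ω‖}, ‖Y ω‖ ^ 2 ∂μ := integral_nonneg fun _ => by positivity
  have hind : Integrable ({ω | δ < ‖Y ω‖}.indicator fun ω => ‖Y ω‖ ^ 2) μ := hn2.indicator₀ hs
  rw [charFun_apply, integral_map hYm.aemeasurable (Continuous.aestronglyMeasurable (by fun_prop)),
    ← hval, ← integral_sub hi3 hlin]
  calc _ ≤ ∫ ω, (4 * ‖t‖ ^ 3 * δ * ‖Y ω‖ ^ 2 +
        4 * ‖t‖ ^ 2 * {ω | δ < ‖Y ω‖}.indicator (fun ω => ‖Y ω‖ ^ 2) ω) ∂μ := by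
        refine norm_integral_le_of_norm_le ((hn2.const_mul _).add (hind.const_mul _))
          (Eventually.of_forall fun ω => ?_)
        have hle : |⟪Y ω, t⟫| ≤ ‖Y ω‖ * ‖t‖ := abs_real_inner_le_norm _ _
        obtain ⟨h2, h3⟩ := norm_exp_mul_I_sub_taylor_le ⟪Y ω, t⟫
        -- Large values use the quadratic remainder; elsewhere the cubic one applies, with `‖Y‖³ ≤
        -- δ‖Y‖²`.
        by_cases hω : δ < ‖Y ω‖
        · rw [Set.indicator_of_mem (by exact hω)]
          refine h2.trans ?_
          rw [← sq_abs]
          have := pow_le_pow_left₀ (abs_nonneg _) hle 2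
          have : 0 ≤ 4 * ‖t‖ ^ 3 * δ * ‖Y ω‖ ^ 2 := by positivity
          nlinarith
        · rw [Set.indicator_of_notMem (by exact hω)]
          refine h3.trans ?_
          have h4 := pow_le_pow_left₀ (abs_nonneg _) hle 3
          have h5 : ‖Y ω‖ ^ 3 ≤ δ * ‖Y ω‖ ^ 2 := by
            rw [pow_succ' _ 2]
            exact mul_le_mul_of_nonneg_right (not_lt.1 hω) (by positivity)
          have h6 := mul_le_mul_of_nonneg_right h5 (by positivity : 0 ≤ ‖t‖ ^ 3)
          nlinarith
    _ = _ := by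
        rw [integral_add (hn2.const_mul _) (hind.const_mul _), integral_const_mul,
          integral_const_mul, hv, integral_indicator₀ hs, mul_one]

end SecondMoments

/-- **Lindeberg's central limit theorem** for proper complex random variables rotated by
deterministic phases that may depend on the number of summands. -/
theorem tendstoInDistribution_sum_rotated {Ω : Type*} [MeasurableSpace Ω] {μ : Measure Ω}
    [IsProbabilityMeasure μ] {X : ℕ → Ω → ℂ} (hX : ∀ n, MemLp (X n) 2 μ) (hi : iIndepFun X μ)
    (hm : ∀ n, ∫ ω, X n ω ∂μ = 0) (hv : ∀ n, ∫ ω, ‖X n ω‖ ^ 2 ∂μ = 1)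
    (hp : ∀ n, ∫ ω, X n ω ^ 2 ∂μ = 0) (hL : LindebergCondition μ X)
    {u : ℕ → ℕ → ℂ} (hu : ∀ N n, ‖u N n‖ = 1) :
    TendstoInDistribution
      (fun (N : ℕ) ω => ∑ n ∈ Finset.range N, ((√(N : ℝ))⁻¹ * u N n : ℂ) * X n ω)
      atTop (id : ℂ → ℂ) (fun _ => μ) (complexGaussian 1) where
  forall_aemeasurable N :=
    Finset.aemeasurable_fun_sum _ fun n _ => (hX n).aestronglyMeasurable.aemeasurable.const_mul _
  tendsto := by
    refine ProbabilityMeasure.tendsto_iff_tendsto_charFun.2 fun t => ?_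
    simp only [ProbabilityMeasure.coe_mk, Measure.map_id, charFun_complexGaussian]
    have hXm (n : ℕ) : AEMeasurable (X n) μ := (hX n).aestronglyMeasurable.aemeasurable
    -- Independence factors the characteristic function, and each complex coefficient passes to the
    -- argument `t` as its conjugate.
    have hchar (N : ℕ) :
        charFun (μ.map fun ω => ∑ n ∈ Finset.range N, ((√(N : ℝ))⁻¹ * u N n : ℂ) * X n ω) t =
          ∏ n ∈ Finset.range N, charFun (μ.map (X n)) (conj ((√(N : ℝ))⁻¹ * u N n : ℂ) * t) := by
      have hi' : iIndepFun (fun n ω => ((√(N : ℝ))⁻¹ * u N n : ℂ) * X n ω) μ :=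
        hi.comp (fun n z => ((√(N : ℝ))⁻¹ * u N n : ℂ) * z) fun n => by fun_prop
      rw [(hi'.restrict _).charFun_map_fun_finsetSum_eq_prod fun n _ => (hXm n).const_mul _,
        Finset.prod_apply]
      refine Finset.prod_congr rfl fun n _ => ?_
      rw [charFun_apply, charFun_apply, integral_map ((hXm n).const_mul _)
        (Continuous.aestronglyMeasurable (by fun_prop)),
        integral_map (hXm n) (Continuous.aestronglyMeasurable (by fun_prop))]
      refine integral_congr_ae (Eventually.of_forall fun ω => ?_)
      simp only [Complex.inner, map_mul]
      congr 4
      ring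
    have hnorm (N n : ℕ) : ‖conj ((√(N : ℝ))⁻¹ * u N n : ℂ) * t‖ = (√(N : ℝ))⁻¹ * ‖t‖ := by
      rw [norm_mul, RCLike.norm_conj, norm_mul, hu, Complex.norm_real,
        Real.norm_of_nonneg (by positivity), mul_one]
    simp_rw [hchar]
    have hlim : Tendsto (fun N : ℕ => ∏ n ∈ Finset.range N, ((1 - ‖t‖ ^ 2 / 4 / N : ℝ) : ℂ))
        atTop (𝓝 (Complex.exp (-(‖t‖ ^ 2 / 4 : ℝ)))) := by
      refine (Complex.tendsto_one_add_div_pow_exp (-(‖t‖ ^ 2 / 4 : ℝ))).congr fun N => ?_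
      rw [Finset.prod_const, Finset.card_range]
      push_cast
      ring
    refine hlim.congr_dist ?_
    have hbound (ε : ℝ) (hε : 0 < ε) : ∀ᶠ N : ℕ in atTop,
        dist (∏ n ∈ Finset.range N, ((1 - ‖t‖ ^ 2 / 4 / N : ℝ) : ℂ))
          (∏ n ∈ Finset.range N, charFun (μ.map (X n)) (conj ((√(N : ℝ))⁻¹ * u N n : ℂ) * t)) ≤
        4 * ‖t‖ ^ 3 * ε + 4 * ‖t‖ ^ 2 * ((N : ℝ)⁻¹ * ∑ n ∈ Finset.range N,
          ∫ ω in {ω | ε * √(N : ℝ) < ‖X n ω‖}, ‖X n ω‖ ^ 2 ∂μ) := by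
      -- `N ≥ ‖t‖²/4` puts the comparison factors `1 - ‖t‖²/(4N)` in the unit disc.
      filter_upwards [eventually_ge_atTop (⌈‖t‖ ^ 2 / 4⌉₊), eventually_gt_atTop 0] with N hN hN0
      have hN0' : (0 : ℝ) < N := by exact_mod_cast hN0
      have hN1 : ‖t‖ ^ 2 / 4 / N ≤ 1 := by
        rw [div_le_one hN0']
        exact Nat.ceil_le.1 hN
      rw [dist_comm, dist_eq_norm]
      refine (norm_prod_sub_prod_le_sum _ _ _ (fun n _ => ?_) (fun n _ => ?_)).trans ?_
      · have := Measure.isProbabilityMeasure_map (hXm n)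
        exact norm_charFun_le_one _
      · rw [Complex.norm_real, Real.norm_eq_abs, abs_le]
        have : 0 ≤ ‖t‖ ^ 2 / 4 / N := by positivity
        constructor <;> linarith
      have hterm (n : ℕ) :
          ‖charFun (μ.map (X n)) (conj ((√(N : ℝ))⁻¹ * u N n : ℂ) * t) -
            ((1 - ‖t‖ ^ 2 / 4 / N : ℝ) : ℂ)‖ ≤ (N : ℝ)⁻¹ * (4 * ‖t‖ ^ 3 * ε) +
            4 * ‖t‖ ^ 2 * ((N : ℝ)⁻¹ *
              ∫ ω in {ω | ε * √(N : ℝ) < ‖X n ω‖}, ‖X n ω‖ ^ 2 ∂μ) := by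
        have := norm_charFun_map_sub_le (hX n) (hm n) (hv n) (hp n)
          (conj ((√(N : ℝ))⁻¹ * u N n : ℂ) * t) (δ := ε * √(N : ℝ)) (by positivity)
        rw [hnorm] at this
        have hs0 : √(N : ℝ) ≠ 0 := (Real.sqrt_pos.2 hN0').ne'
        have e2 : ((√(N : ℝ))⁻¹ * ‖t‖) ^ 2 = (N : ℝ)⁻¹ * ‖t‖ ^ 2 := by
          rw [mul_pow, inv_pow, Real.sq_sqrt hN0'.le]
        have e3 : ((√(N : ℝ))⁻¹ * ‖t‖) ^ 3 * (ε * √(N : ℝ)) = (N : ℝ)⁻¹ * ‖t‖ ^ 3 * ε := by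
          calc _ = ((√(N : ℝ))⁻¹ * ‖t‖) ^ 2 * (‖t‖ * ε) * ((√(N : ℝ))⁻¹ * √(N : ℝ)) := by ring
            _ = _ := by rw [e2, inv_mul_cancel₀ hs0]; ring
        calc _ = _ := by rw [e2]; congr 4; ring
          _ ≤ _ := this
          _ = _ := by rw [mul_assoc 4, e3, e2]; ring
      refine (Finset.sum_le_sum fun n _ => hterm n).trans_eq ?_
      rw [Finset.sum_add_distrib, Finset.sum_const, Finset.card_range, nsmul_eq_mul,
        ← Finset.mul_sum, ← Finset.mul_sum, mul_inv_cancel_left₀ hN0'.ne']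
    refine tendsto_order.2 ⟨fun a ha => Eventually.of_forall fun N => ha.trans_le dist_nonneg,
      fun η hη => ?_⟩
    -- This truncation level keeps the cubic term below `η`; the `+ 1` covers `t = 0`.
    have hc : 0 < 8 * ‖t‖ ^ 3 + 1 := by positivity
    have hε : 0 < η / (8 * ‖t‖ ^ 3 + 1) := by positivity
    have hlt : 4 * ‖t‖ ^ 3 * (η / (8 * ‖t‖ ^ 3 + 1)) < η := by
      rw [mul_div_assoc', div_lt_iff₀ hc]
      nlinarith [mul_nonneg hη.le (pow_nonneg (norm_nonneg t) 3)]
    have hT := ((hL _ hε).const_mul (4 * ‖t‖ ^ 2)).const_add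
      (4 * ‖t‖ ^ 3 * (η / (8 * ‖t‖ ^ 3 + 1)))
    rw [mul_zero, add_zero] at hT
    filter_upwards [hbound _ hε, hT.eventually_lt_const hlt] with N h1 h2 using h1.trans_lt h2

end CentralLimit

/-! ### Scaling and continuity of the zero-forcing SNR -/

section ZeroForcing

variable {K M : ℕ}

/-- Cramer's rule isolates the determinant as the only source of discontinuity. It also holds for a
singular Gram matrix, where both inverses are zero by convention. -/
theorem zfMatrix_apply (G : Matrix (Fin K) (Fin M) ℂ) (m : Fin M) (k : Fin K) :
    zfMatrix G m k = (G * Gᴴ).det⁻¹ * (Gᴴ * (G * Gᴴ).adjugate) m k := by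
  rw [zfMatrix, Matrix.inv_def, Ring.inverse_eq_inv', Matrix.mul_smul, Matrix.smul_apply,
    smul_eq_mul]

/-- Only the diagonal factor is cancelled, so the Gram matrix of `H` may be singular. -/
theorem zfMatrix_diagonal_mul {d : Fin K → ℝ} (hd : ∀ k, 0 < d k)
    (H : Matrix (Fin K) (Fin M) ℂ) (m : Fin M) (k : Fin K) :
    zfMatrix (Matrix.diagonal (fun k => (d k : ℂ)) * H) m k = zfMatrix H m k * ((d k)⁻¹ : ℝ) := by
  set D : Matrix (Fin K) (Fin K) ℂ := Matrix.diagonal fun k => (d k : ℂ) with hD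
  have hdet : IsUnit D.det := by
    rw [hD, Matrix.det_diagonal, isUnit_iff_ne_zero, Finset.prod_ne_zero_iff]
    exact fun k _ => by exact_mod_cast (hd k).ne'
  have hDinv : D⁻¹ = Matrix.diagonal fun k => (((d k)⁻¹ : ℝ) : ℂ) := by
    refine Matrix.inv_eq_right_inv ?_
    rw [hD, Matrix.diagonal_mul_diagonal, ← Matrix.diagonal_one]
    congr 1
    funext k
    rw [← Complex.ofReal_mul, mul_inv_cancel₀ (hd k).ne', Complex.ofReal_one]
  have hDh : Dᴴ = D := by
    rw [hD, Matrix.diagonal_conjTranspose]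
    congr 1
    funext k
    simp
  have h : zfMatrix (D * H) = zfMatrix H * D⁻¹ := by
    rw [zfMatrix, zfMatrix, Matrix.conjTranspose_mul, hDh,
      show D * H * (Hᴴ * D) = D * (H * Hᴴ) * D by simp only [Matrix.mul_assoc],
      Matrix.mul_inv_rev, Matrix.mul_inv_rev, Matrix.mul_assoc,
      Matrix.mul_nonsing_inv_cancel_left _ _ hdet, Matrix.mul_assoc]
  rw [h, hDinv, Matrix.mul_diagonal]

theorem zfPrecoder_diagonal_mul {d : Fin K → ℝ} (hd : ∀ k, 0 < d k)
    (H : Matrix (Fin K) (Fin M) ℂ) :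
    zfPrecoder (Matrix.diagonal (fun k => (d k : ℂ)) * H) = zfPrecoder H := by
  ext m k
  have hs : √(∑ i, ‖zfMatrix H i k * ((d k)⁻¹ : ℝ)‖ ^ 2) =
      √(∑ i, ‖zfMatrix H i k‖ ^ 2) * (d k)⁻¹ := by
    simp_rw [norm_mul, mul_pow, Complex.norm_real, Real.norm_eq_abs, sq_abs]
    rw [← Finset.sum_mul, Real.sqrt_mul' _ (by positivity), Real.sqrt_sq (inv_nonneg.2 (hd k).le)]
  simp only [zfPrecoder, Matrix.of_apply, zfMatrix_diagonal_mul hd]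
  rw [hs, Complex.ofReal_mul, mul_div_mul_right]
  exact_mod_cast (inv_pos.2 (hd k)).ne'

/-- The signal-to-noise ratio under zero-forcing is quadratic in the scale of the user's row. -/
theorem snr_diagonal_mul (P σ : ℝ) (Λ : Matrix (Fin K) (Fin K) ℂ) {d : Fin K → ℝ}
    (hd : ∀ k, 0 < d k) (H : Matrix (Fin K) (Fin M) ℂ) (k : Fin K) :
    snr P σ Λ (Matrix.diagonal (fun k => (d k : ℂ)) * H) k = d k ^ 2 * snr P σ Λ H k := by
  rw [snr, snr, zfPrecoder_diagonal_mul hd, Matrix.mul_assoc, Matrix.diagonal_mul, norm_mul,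
    mul_pow, Complex.norm_real, Real.norm_eq_abs, sq_abs]
  ring

theorem snr_smul (P σ : ℝ) (Λ : Matrix (Fin K) (Fin K) ℂ) {c : ℝ} (hc : 0 ≤ c)
    (H : Matrix (Fin K) (Fin M) ℂ) (k : Fin K) :
    snr P σ Λ ((c : ℂ) • H) k = c ^ 2 * snr P σ Λ H k := by
  -- The degenerate scale `c = 0` does occur: it is `(Γ√N)⁻¹` at `N = 0`.
  rcases hc.eq_or_lt with rfl | hc
  · simp [snr]
  · rw [← snr_diagonal_mul P σ Λ (d := fun _ => c) (fun _ => hc), Matrix.smul_eq_diagonal_mul]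

theorem continuous_of_mul_conjTranspose :
    Continuous fun Z : Fin K → Fin M → ℂ => Matrix.of Z * (Matrix.of Z)ᴴ :=
  Continuous.matrix_mul continuous_id continuous_id.matrix_conjTranspose

theorem continuous_zfMatrix_numerator (m : Fin M) (k : Fin K) :
    Continuous fun Z : Fin K → Fin M → ℂ =>
      ((Matrix.of Z)ᴴ * (Matrix.of Z * (Matrix.of Z)ᴴ).adjugate) m k :=
  (Continuous.matrix_mul (Continuous.matrix_conjTranspose continuous_id)
    continuous_of_mul_conjTranspose.matrix_adjugate).matrix_elem m k

theorem measurable_snr (P σ : ℝ) (Λ : Matrix (Fin K) (Fin K) ℂ) (k : Fin K) :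
    Measurable fun Z : Fin K → Fin M → ℂ => snr P σ Λ (Matrix.of Z) k := by
  have hV (m : Fin M) : Measurable fun Z : Fin K → Fin M → ℂ => zfMatrix (Matrix.of Z) m k := by
    simp_rw [zfMatrix_apply]
    exact continuous_of_mul_conjTranspose.matrix_det.measurable.inv.mul
      (continuous_zfMatrix_numerator m k).measurable
  simp only [snr, Matrix.mul_apply, zfPrecoder, Matrix.of_apply]
  fun_prop

theorem continuousAt_snr (P σ : ℝ) (Λ : Matrix (Fin K) (Fin K) ℂ) (k : Fin K)
    {Z : Fin K → Fin M → ℂ} (hZ : (Matrix.of Z * (Matrix.of Z)ᴴ).det ≠ 0) :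
    ContinuousAt (fun Z : Fin K → Fin M → ℂ => snr P σ Λ (Matrix.of Z) k) Z := by
  have hV (m : Fin M) :
      ContinuousAt (fun Z : Fin K → Fin M → ℂ => zfMatrix (Matrix.of Z) m k) Z := by
    simp_rw [zfMatrix_apply]
    exact (continuous_of_mul_conjTranspose.matrix_det.continuousAt.inv₀ hZ).mul
      (continuous_zfMatrix_numerator m k).continuousAt
  -- A zero column of `V` would contradict `(G V)ₖₖ = 1`, so the normalization does not divide by
  -- zero.
  have hpos : √(∑ i, ‖zfMatrix (Matrix.of Z) i k‖ ^ 2) ≠ 0 := by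
    rw [Real.sqrt_ne_zero (by positivity)]
    intro h0
    rw [Finset.sum_eq_zero_iff_of_nonneg fun _ _ => by positivity] at h0
    have h1 : (Matrix.of Z * zfMatrix (Matrix.of Z)) k k = 1 := by
      rw [zfMatrix, ← Matrix.mul_assoc, Matrix.mul_nonsing_inv _ (isUnit_iff_ne_zero.2 hZ),
        Matrix.one_apply_eq]
    rw [Matrix.mul_apply, Finset.sum_eq_zero fun m hm => by simp [norm_eq_zero.1
      (pow_eq_zero_iff two_ne_zero |>.1 (h0 m hm))]] at h1
    exact zero_ne_one h1
  have hs : ContinuousAt (fun Z : Fin K → Fin M → ℂ =>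
      ((√(∑ i, ‖zfMatrix (Matrix.of Z) i k‖ ^ 2) : ℝ) : ℂ)) Z := by
    refine Complex.continuous_ofReal.continuousAt.comp (Real.continuous_sqrt.continuousAt.comp ?_)
    exact tendsto_finsetSum _ fun m _ => (hV m).norm.pow 2
  have hc (m : Fin M) : ContinuousAt (fun Z : Fin K → Fin M → ℂ => Z k m) Z :=
    (continuous_apply_apply k m).continuousAt
  simp only [snr, Matrix.mul_apply, zfPrecoder, Matrix.of_apply]
  refine continuousAt_const.mul (ContinuousAt.pow (ContinuousAt.norm ?_) 2)
  exact tendsto_finsetSum _ fun m _ =>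
    (hc m).mul ((hV m).div hs (by exact_mod_cast hpos))

open scoped ComplexOrder in
-- A left null vector of `G Gᴴ` annihilates `G` itself, hence every choice of `K` columns.
theorem det_mul_conjTranspose_ne_zero {G : Matrix (Fin K) (Fin M) ℂ} (f : Fin K → Fin M)
    (h : (G.submatrix id f).det ≠ 0) : (G * Gᴴ).det ≠ 0 := by
  contrapose! h
  obtain ⟨v, hv, hvG⟩ := Matrix.exists_vecMul_eq_zero_iff.2 h
  rw [Matrix.vecMul_self_mul_conjTranspose_eq_zero] at hvG
  refine Matrix.exists_vecMul_eq_zero_iff.1 ⟨v, hv, ?_⟩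
  funext k
  exact congrFun hvG (f k)

end ZeroForcing

/-! ### Almost sure invertibility of the Gaussian Gram matrix -/

theorem complexGaussian_absolutelyContinuous {v : ℝ≥0} (hv : v ≠ 0) :
    complexGaussian v ≪ volume := by
  have h := Complex.volume_preserving_equiv_real_prod.symm
  have hmap : complexGaussian v = ((gaussianReal 0 (v / 2)).prod (gaussianReal 0 (v / 2))).map
      Complex.measurableEquivRealProd.symm := by
    rw [complexGaussian]
    congr 1
    funext p
    apply Complex.ext <;> simp
  have hv2 : v / 2 ≠ 0 := div_ne_zero hv two_ne_zero
  rw [hmap, ← h.map_eq]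
  exact ((gaussianReal_absolutelyContinuous 0 hv2).prod
    (gaussianReal_absolutelyContinuous 0 hv2)).map h.measurable

theorem complexGaussianArray_absolutelyContinuous (K M : ℕ) :
    complexGaussianArray K M ≪ volume :=
  Measure.AbsolutelyContinuous.pi_fin fun _ => Measure.AbsolutelyContinuous.pi_fin fun _ =>
    complexGaussian_absolutelyContinuous one_ne_zero

/-- The determinant is the monic characteristic polynomial of `-B` evaluated at `t`. -/
theorem finite_det_add_smul_one_eq_zero {n : ℕ} (B : Matrix (Fin n) (Fin n) ℂ) :
    {t : ℝ | (B + (t : ℂ) • (1 : Matrix (Fin n) (Fin n) ℂ)).det = 0}.Finite := by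
  have hp : ({z : ℂ | (-B).charpoly.IsRoot z}).Finite :=
    Polynomial.finite_setOfPred_isRoot (-B).charpoly_monic.ne_zero
  refine (hp.preimage (Complex.ofReal_injective.injOn)).subset fun t ht => ?_
  rw [Set.mem_preimage, Set.mem_ofPred_eq, Polynomial.IsRoot, Matrix.eval_charpoly, ← ht,
    sub_neg_eq_add, add_comm, Matrix.scalar_apply, ← Matrix.smul_one_eq_diagonal]

theorem ae_det_mul_conjTranspose_ne_zero {K M : ℕ} (hKM : K ≤ M) :
    ∀ᵐ Z ∂complexGaussianArray K M, (Matrix.of Z * (Matrix.of Z)ᴴ).det ≠ 0 := by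
  refine (complexGaussianArray_absolutelyContinuous K M).ae_le ?_
  -- `J` is the identity in the first `K` columns, so along each line `Z + tJ` the leading minor is
  -- `det(B + t)`, with finitely many zeros. A Fubini argument over these parallel lines makes the
  -- singular set null.
  let J : Fin K → Fin M → ℂ := fun k m => if m = Fin.castLE hKM k then 1 else 0
  let L : ℝ →ₗ[ℝ] (Fin K → Fin M → ℂ) := LinearMap.toSpanSingleton ℝ _ J
  have hS : MeasurableSet {Z : Fin K → Fin M → ℂ | (Matrix.of Z * (Matrix.of Z)ᴴ).det ≠ 0} :=
    (isOpen_ne_fun continuous_of_mul_conjTranspose.matrix_det continuous_const).measurableSet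
  have hrow : (volume : Measure (Fin M → ℂ)).IsAddHaarMeasure := by
    rw [volume_pi]
    infer_instance
  have harray : (volume : Measure (Fin K → Fin M → ℂ)).IsAddHaarMeasure :=
    Measure.pi.isAddHaarMeasure fun _ : Fin K => (volume : Measure (Fin M → ℂ))
  refine ae_mem_of_ae_add_linearMap_mem L volume volume hS fun Z => ?_
  have hfin := finite_det_add_smul_one_eq_zero ((Matrix.of Z).submatrix id (Fin.castLE hKM))
  filter_upwards [hfin.measure_zero volume |> compl_mem_ae_iff.2] with t ht
  refine det_mul_conjTranspose_ne_zero (Fin.castLE hKM) fun h0 => ht ?_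
  rw [Set.mem_ofPred_eq, ← h0]
  congr 1
  ext i j
  simp [L, J, Matrix.one_apply, eq_comm]

/-! ### Joint convergence of the channel entries -/

/-- Random vectors with independent coordinates that converge in distribution coordinatewise
converge jointly, to the product of the limit laws. -/
theorem MeasureTheory.TendstoInDistribution.pi_of_iIndepFun {Ω ι κ E : Type*} [MeasurableSpace Ω]
    {μ : Measure Ω} [IsProbabilityMeasure μ] [Fintype κ] [TopologicalSpace E] [MeasurableSpace E]
    [BorelSpace E] [SecondCountableTopology E]
    [TopologicalSpace.PseudoMetrizableSpace E] {X : κ → ι → Ω → E}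
    {l : Filter ι} {ν : κ → Measure E} [∀ j, IsProbabilityMeasure (ν j)]
    (hX : ∀ j, TendstoInDistribution (X j) l id (fun _ => μ) (ν j))
    (hi : ∀ i, iIndepFun (fun j => X j i) μ) :
    TendstoInDistribution (fun i ω j => X j i ω) l id (fun _ => μ) (Measure.pi ν) where
  forall_aemeasurable i := aemeasurable_pi_iff.2 fun j => (hX j).forall_aemeasurable i
  aemeasurable_limit := aemeasurable_id
  tendsto := by
    -- Forming finite products is weakly continuous, and by independence each joint law is the
    -- product of its marginals.
    have h := (ProbabilityMeasure.continuous_pi (α := fun _ : κ => E)).continuousAt.tendsto.comp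
      (tendsto_pi_nhds.2 fun j => (hX j).tendsto)
    have hlim : ProbabilityMeasure.pi (fun j => (⟨(ν j).map id,
        Measure.isProbabilityMeasure_map aemeasurable_id⟩ : ProbabilityMeasure E)) =
        ⟨(Measure.pi ν).map id, Measure.isProbabilityMeasure_map aemeasurable_id⟩ :=
      Subtype.ext (by simp [ProbabilityMeasure.pi])
    rw [hlim] at h
    exact h.congr fun i => Subtype.ext
      ((hi i).map_fun_eq_pi_map fun j => (hX j).forall_aemeasurable i).symm

section Fading

variable {Ω : Type*} [MeasurableSpace Ω] {μ : Measure Ω} {K M : ℕ}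
  {h : ℕ → Fin K → Fin M → Ω → ℂ}

theorem IsFading.aemeasurable (hh : IsFading μ h) (n : ℕ) (k : Fin K) (m : Fin M) :
    AEMeasurable (h n k m) μ :=
  (hh.memLp n k m).aestronglyMeasurable.aemeasurable

theorem IsFading.tendstoInDistribution_entry [IsProbabilityMeasure μ] (hh : IsFading μ h)
    {u : ℕ → ℕ → ℂ} (hu : ∀ N n, ‖u N n‖ = 1) (k : Fin K) (m : Fin M) :
    TendstoInDistribution
      (fun (N : ℕ) ω => ∑ n ∈ Finset.range N, (((√(N : ℝ))⁻¹ : ℝ) * u N n : ℂ) * h n k m ω)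
      atTop (id : ℂ → ℂ) (fun _ => μ) (complexGaussian 1) :=
  tendstoInDistribution_sum_rotated (fun n => hh.memLp n k m)
    (hh.indep.precomp (g := fun n => (n, k, m)) fun _ _ hab => (Prod.ext_iff.1 hab).1)
    (fun n => hh.mean n k m) (fun n => hh.variance n k m) (fun n => hh.pseudoVariance n k m)
    (hh.lindeberg k m) hu

/-- The normalized reflected channel matrix converges in distribution to a matrix with independent
standard complex Gaussian entries. -/
theorem IsFading.tendstoInDistribution_array [IsProbabilityMeasure μ] (hh : IsFading μ h)
    {u : ℕ → ℕ → ℂ} (hu : ∀ N n, ‖u N n‖ = 1) :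
    TendstoInDistribution
      (fun (N : ℕ) ω (k : Fin K) (m : Fin M) =>
        ∑ n ∈ Finset.range N, (((√(N : ℝ))⁻¹ : ℝ) * u N n : ℂ) * h n k m ω)
      atTop id (fun _ => μ) (complexGaussianArray K M) := by
  -- The limit is a product of products, so rows are assembled from entries and the array from rows.
  -- Independence at each level comes from regrouping the index triples into disjoint blocks.
  refine TendstoInDistribution.pi_of_iIndepFun (X := fun k N ω m =>
    ∑ n ∈ Finset.range N, (((√(N : ℝ))⁻¹ : ℝ) * u N n : ℂ) * h n k m ω) (fun k => ?_) fun N => ?_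
  · refine TendstoInDistribution.pi_of_iIndepFun (X := fun m N ω =>
      ∑ n ∈ Finset.range N, (((√(N : ℝ))⁻¹ : ℝ) * u N n : ℂ) * h n k m ω)
      (fun m => hh.tendstoInDistribution_entry hu k m) fun N => ?_
    have hi : iIndepFun (fun p : Fin M × ℕ => h p.2 k p.1) μ :=
      hh.indep.precomp (g := fun p : Fin M × ℕ => (p.2, k, p.1)) fun a b hab => by
        simp only [Prod.mk.injEq, true_and] at hab
        exact Prod.ext hab.2 hab.1
    exact (hi.curry (X := fun m n => h n k m) fun m n => hh.aemeasurable n k m).comp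
      (fun _ x => ∑ n ∈ Finset.range N, (((√(N : ℝ))⁻¹ : ℝ) * u N n : ℂ) * x n)
      fun _ => by fun_prop
  · have hi : iIndepFun (fun p : Fin K × Fin M × ℕ => h p.2.2 p.1 p.2.1) μ :=
      hh.indep.precomp (g := fun p : Fin K × Fin M × ℕ => (p.2.2, p.1, p.2.1)) fun a b hab => by
        simp only [Prod.mk.injEq] at hab
        exact Prod.ext hab.2.1 (Prod.ext hab.2.2 hab.1)
    exact (hi.curry (X := fun k p => h p.2 k p.1) fun k p => hh.aemeasurable p.2 k p.1).comp
      (fun _ x m => ∑ n ∈ Finset.range N, (((√(N : ℝ))⁻¹ : ℝ) * u N n : ℂ) * x (m, n))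
      fun _ => by fun_prop

end Fading

/-! ### Normalization and conclusion -/

/-- User `k`'s SNR feels only its own row scale, squared, so the other path losses drop out. At `N =
0` both sides are zero, by division by zero on the left. -/
theorem snr_channelMatrix_div {K M : ℕ} (P σ : ℝ) (Λ : Matrix (Fin K) (Fin K) ℂ) {Γ : ℝ}
    (hΓ : 0 < Γ) (N : ℕ) {β : Fin K → ℝ} (hβ : ∀ k, 0 < β k) (H : Matrix (Fin K) (Fin M) ℂ)
    (k : Fin K) :
    snr P σ Λ (channelMatrix β H) k / (Γ ^ 2 * N / β k) =
      snr P σ Λ ((((Γ * √(N : ℝ))⁻¹ : ℝ) : ℂ) • H) k := by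
  rw [channelMatrix, snr_diagonal_mul P σ Λ fun k => inv_pos.2 (Real.sqrt_pos.2 (hβ k)),
    snr_smul P σ Λ (by positivity), inv_pow, Real.sq_sqrt (hβ k).le, inv_pow, mul_pow,
    Real.sq_sqrt (Nat.cast_nonneg N), div_div_eq_mul_div, mul_comm (β k)⁻¹, mul_assoc,
    inv_mul_cancel₀ (hβ k).ne', mul_one, div_eq_inv_mul]

theorem proposition1 {Ω : Type*} [MeasurableSpace Ω] (μ : Measure Ω) [IsProbabilityMeasure μ]
    {K M : ℕ} (hKM : K ≤ M)
    -- the fading coefficients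
    (h : ℕ → Fin K → Fin M → Ω → ℂ) (hh : IsFading μ h)
    -- reflection amplitude, and phase shifts `θ N n`, `n < N`, of the surface with `N` elements
    (Γ : ℝ) (hΓ : Γ ∈ Set.Ioc (0 : ℝ) 1) (θ : ℕ → ℕ → ℝ)
    -- path losses `β N k`, transmit power, noise level, power allocation
    (β : ℕ → Fin K → ℝ) (hβ : ∀ N k, 0 < β N k)
    (P σ : ℝ) (hP : 0 < P) (hσ : 0 < σ)
    (Λ : Matrix (Fin K) (Fin K) ℂ) (hΛ : (Λ * Λᴴ).trace = 1) :
    (∀ (k : Fin K) (m : Fin M),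
      TendstoInDistribution
        (fun (N : ℕ) (ω : Ω) =>
          (∑ n ∈ Finset.range N, h n k m ω * reflectionFactor Γ (θ N n)) /
            ((Γ * √(N : ℝ) : ℝ) : ℂ))
        atTop (id : ℂ → ℂ) (fun _ => μ) (complexGaussian 1)) ∧
    (∀ k : Fin K,
      TendstoInDistribution
        (fun (N : ℕ) (ω : Ω) =>
          snr P σ Λ
              (channelMatrix (β N) (reflectedMatrix Γ N (θ N) fun n k m => h n k m ω)) k /
            (Γ ^ 2 * N / β N k))
        atTop (fun Z : Fin K → Fin M → ℂ => snr P σ Λ (Matrix.of Z) k)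
        (fun _ => μ) (complexGaussianArray K M)) := by
  have hu (N n : ℕ) : ‖Complex.exp (-((θ N n : ℂ) * Complex.I))‖ = 1 := by
    rw [← neg_mul, ← Complex.ofReal_neg, Complex.norm_exp_ofReal_mul_I]
  have hΓ0 : (Γ : ℂ) ≠ 0 := by exact_mod_cast hΓ.1.ne'
  -- The amplitude `Γ` cancels, leaving unimodular weights as the limit theorem requires.
  have hentry (N : ℕ) (x : ℕ → ℂ) :
      ∑ n ∈ Finset.range N, (((√(N : ℝ))⁻¹ : ℝ) * Complex.exp (-((θ N n : ℂ) * Complex.I)) : ℂ) *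
        x n = (((Γ * √(N : ℝ))⁻¹ : ℝ) : ℂ) *
          ∑ n ∈ Finset.range N, x n * reflectionFactor Γ (θ N n) := by
    rw [Finset.mul_sum]
    refine Finset.sum_congr rfl fun n _ => ?_
    rw [reflectionFactor, mul_inv, Complex.ofReal_mul, Complex.ofReal_inv Γ]
    field_simp
  refine ⟨fun k m => ?_, fun k => ?_⟩
  · refine (hh.tendstoInDistribution_entry hu k m).congr (fun N => ?_) EventuallyEq.rfl
    refine Eventually.of_forall fun ω => ?_
    simp only [hentry N fun n => h n k m ω]
    rw [Complex.ofReal_inv, div_eq_inv_mul]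
  · refine ((hh.tendstoInDistribution_array hu).comp_of_ae_continuousAt (measurable_snr P σ Λ k)
      ?_).congr (fun N => Eventually.of_forall fun ω => ?_) EventuallyEq.rfl
    · filter_upwards [ae_det_mul_conjTranspose_ne_zero hKM] with Z hZ
      exact continuousAt_snr P σ Λ k hZ
    · simp only [Function.comp_apply, snr_channelMatrix_div P σ Λ hΓ.1 N (hβ N)]
      congr 1
      ext k m
      exact hentry N fun n => h n k m ω
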